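/- For a metric space $(X,d)$, the generalized roundness $\mathrm{gr}(X,d)\in[0,\infty]$ is the supremum of all real $p>0$ such that for every $m\ge 2$ and all points $a_1,\dots,a_m,b_1,\dots,b_m\in X$ (not necessarily distinct), $$\sum_{1\le i<j\le m}\bigl(d(a_i,a_j)^p+d(b_i,b_j)^p\bigr)\le\sum_{1\le i,j\le m}d(a_i,b_j)^p .$$ For a group $G$ with generating set $S$, the word metric is $d_S(g,h)=$ the least length of a word in the elements of $S\cup S^{-1}$ representing $g^{-1}h$. Let $n\ge 2$. 1. If $\mathbb{Z}^n$ carries the word metric associated with its canonical basis, then $\mathrm{gr}(\mathbb{Z}^n)=1$. 2. If the free group $F_n$ of rank $n$ carries the word metric associated with any free generating set, then $\mathrm{gr}(F_n)=1$. -/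

import Mathlib

/-- The word length of `g` with respect to `S`: the least length of a word in the letters
`S ∪ S⁻¹` whose product is `g`. (It is only meaningful when `S` generates the group.) -/
@[to_additive addWordLength /-- The word length of `g` with respect to `S`: the least length of a word in the
letters `S ∪ -S` whose sum is `g`. (It is only meaningful when `S` generates the group.) -/]
noncomputable def wordLength {G : Type*} [Group G] (S : Set G) (g : G) : ℕ :=
  sInf {k : ℕ | ∃ w : List G, (∀ x ∈ w, x ∈ S ∨ x⁻¹ ∈ S) ∧ w.prod = g ∧ w.length = k}

/-- The (left-invariant) word metric on `G` with respect to a generating set `S`. -/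
@[to_additive addWordDist /-- The (left-invariant) word metric on `G` with respect to a generating
set `S`. -/]
noncomputable def wordDist {G : Type*} [Group G] (S : Set G) (g h : G) : ℝ :=
  (wordLength S (g⁻¹ * h) : ℝ)

/-- `S` is a free generating set of `G`: the homomorphism from the free group on `S` to `G`
which extends the inclusion of `S` is an isomorphism. -/
def IsFreeGeneratingSet {G : Type*} [Group G] (S : Set G) : Prop :=
  Function.Bijective (FreeGroup.lift (fun s : S => (s : G)))

/-- The roundness inequalities with exponent `p` for the distance `d`: they are required for
all `n ≥ 2` and all families of `2n` points, not necessarily distinct. -/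
def HasRoundnessExponent {X : Type*} (d : X → X → ℝ) (p : ℝ) : Prop :=
  ∀ n : ℕ, 2 ≤ n → ∀ a b : Fin n → X,
    ∑ i : Fin n, ∑ j ∈ Finset.Ioi i, (d (a i) (a j) ^ p + d (b i) (b j) ^ p) ≤
      ∑ i : Fin n, ∑ j : Fin n, d (a i) (b j) ^ p

/-- The generalized roundness of `(X, d)`: the supremum in `[0, ∞]` of all `p > 0` for which the
roundness inequalities hold. -/
noncomputable def generalizedRoundness {X : Type*} (d : X → X → ℝ) : ENNReal :=
  sSup (ENNReal.ofReal '' {p : ℝ | 0 < p ∧ HasRoundnessExponent d p})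

section Sums

lemma sum_sum_eq_two_mul_sum_Ioi {m : ℕ} (g : Fin m → Fin m → ℝ) (hg : ∀ i j, g i j = g j i)
    (h0 : ∀ i, g i i = 0) :
    ∑ i, ∑ j, g i j = 2 * ∑ i, ∑ j ∈ Finset.Ioi i, g i j := by
  have hsplit : ∀ i, ∑ j, g i j = ∑ j ∈ Finset.Ioi i, g i j + ∑ j ∈ Finset.Iio i, g i j := by
    intro i
    simp only [Finset.sum_filter, ← Finset.filter_lt_eq_Ioi, ← Finset.filter_gt_eq_Iio,
      ← Finset.sum_add_distrib]
    refine Finset.sum_congr rfl fun j _ => ?_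
    rcases lt_trichotomy i j with h | rfl | h
    · simp [h, h.not_gt]
    · simp [h0]
    · simp [h, h.not_gt]
  have hswap : ∑ i, ∑ j ∈ Finset.Iio i, g i j = ∑ i, ∑ j ∈ Finset.Ioi i, g i j := by
    simp only [← Finset.filter_lt_eq_Ioi, ← Finset.filter_gt_eq_Iio, Finset.sum_filter]
    rw [Finset.sum_comm]
    exact Finset.sum_congr rfl fun i _ => Finset.sum_congr rfl fun j _ => by rw [hg]
  simp only [hsplit, Finset.sum_add_distrib]
  rw [hswap]
  ring

lemma sum_sum_sub_sq {m : ℕ} (x y : Fin m → ℝ) :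
    ∑ i, ∑ j, (x i - y j) ^ 2 =
      m * ∑ i, x i ^ 2 + m * ∑ i, y i ^ 2 - 2 * ((∑ i, x i) * ∑ i, y i) := by
  simp only [sub_sq, Finset.sum_add_distrib, Finset.sum_sub_distrib, Finset.sum_const,
    Finset.card_univ, Fintype.card_fin, nsmul_eq_mul, ← Finset.mul_sum, ← Finset.sum_mul]
  ring

/-- Squared differences of reals are of negative type. -/
lemma sum_Ioi_sub_sq_le {m : ℕ} (x y : Fin m → ℝ) :
    ∑ i, ∑ j ∈ Finset.Ioi i, ((x i - x j) ^ 2 + (y i - y j) ^ 2) ≤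
      ∑ i, ∑ j, (x i - y j) ^ 2 := by
  have h := sum_sum_eq_two_mul_sum_Ioi (fun i j => (x i - x j) ^ 2 + (y i - y j) ^ 2)
    (fun i j => by ring) (fun i => by ring)
  simp only [Finset.sum_add_distrib (s := Finset.univ)] at h
  rw [sum_sum_sub_sq, sum_sum_sub_sq] at h
  rw [sum_sum_sub_sq]
  nlinarith [sq_nonneg (∑ i, x i - ∑ i, y i)]

end Sums

section Roundness

variable {X : Type*} {d : X → X → ℝ}

lemma Finset.sum_sub_indicator_sq {ι : Type*} [DecidableEq ι] {T A B : Finset ι}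
    (hA : A ⊆ T) (hB : B ⊆ T) :
    ∑ c ∈ T, ((if c ∈ A then (1 : ℝ) else 0) - (if c ∈ B then (1 : ℝ) else 0)) ^ 2 =
      (A.card : ℝ) + (B.card : ℝ) - 2 * ((A ∩ B).card : ℝ) := by
  have h : ∀ c, ((if c ∈ A then (1 : ℝ) else 0) - (if c ∈ B then (1 : ℝ) else 0)) ^ 2 =
      (if c ∈ A then (1 : ℝ) else 0) + (if c ∈ B then (1 : ℝ) else 0) -
        2 * (if c ∈ A ∩ B then (1 : ℝ) else 0) := by
    intro c
    by_cases hA : c ∈ A <;> by_cases hB : c ∈ B <;> norm_num [hA, hB]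
  simp only [h, Finset.sum_sub_distrib, Finset.sum_add_distrib, ← Finset.mul_sum,
    Finset.sum_boole, Finset.filter_mem_eq_inter, Finset.inter_eq_right.2 hA,
    Finset.inter_eq_right.2 hB, Finset.inter_eq_right.2 (Finset.inter_subset_left.trans hA)]

/-- A distance which on finite sets is a cardinality of symmetric differences satisfies the
roundness inequalities with exponent one. -/
lemma hasRoundnessExponent_one_of_card
    (h : ∀ A : Set X, A.Finite → ∃ (ι : Type) (_ : DecidableEq ι) (P : X → Finset ι),
      ∀ x ∈ A, ∀ y ∈ A, d x y = (P x).card + (P y).card - 2 * (P x ∩ P y).card) :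
    HasRoundnessExponent d 1 := by
  intro m _ a b
  obtain ⟨ι, _, P, hP⟩ := h (Set.range a ∪ Set.range b)
    ((Set.finite_range a).union (Set.finite_range b))
  set T : Finset ι := Finset.univ.biUnion (fun i => P (a i) ∪ P (b i))
  have ha : ∀ i, P (a i) ⊆ T := fun i =>
    Finset.subset_union_left.trans (Finset.subset_biUnion_of_mem (fun i => P (a i) ∪ P (b i))
      (Finset.mem_univ i))
  have hb : ∀ i, P (b i) ⊆ T := fun i =>
    Finset.subset_union_right.trans (Finset.subset_biUnion_of_mem (fun i => P (a i) ∪ P (b i))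
      (Finset.mem_univ i))
  set f : X → ι → ℝ := fun x c => if c ∈ P x then 1 else 0
  have haa : ∀ i j, d (a i) (a j) = ∑ c ∈ T, (f (a i) c - f (a j) c) ^ 2 := fun i j => by
    rw [hP _ (by simp) _ (by simp), ← Finset.sum_sub_indicator_sq (ha i) (ha j)]
  have hbb : ∀ i j, d (b i) (b j) = ∑ c ∈ T, (f (b i) c - f (b j) c) ^ 2 := fun i j => by
    rw [hP _ (by simp) _ (by simp), ← Finset.sum_sub_indicator_sq (hb i) (hb j)]
  have hab : ∀ i j, d (a i) (b j) = ∑ c ∈ T, (f (a i) c - f (b j) c) ^ 2 := fun i j => by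
    rw [hP _ (by simp) _ (by simp), ← Finset.sum_sub_indicator_sq (ha i) (hb j)]
  simp only [Real.rpow_one, haa, hbb, hab, ← Finset.sum_add_distrib]
  calc _ = ∑ c ∈ T, ∑ i, ∑ j ∈ Finset.Ioi i,
        ((f (a i) c - f (a j) c) ^ 2 + (f (b i) c - f (b j) c) ^ 2) := by
        rw [Finset.sum_comm]
        exact Finset.sum_congr rfl fun i _ => Finset.sum_comm
    _ ≤ ∑ c ∈ T, ∑ i, ∑ j, (f (a i) c - f (b j) c) ^ 2 :=
        Finset.sum_le_sum fun c _ => sum_Ioi_sub_sq_le (fun i => f (a i) c) (fun i => f (b i) c)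
    _ = _ := by
        rw [Finset.sum_comm]
        exact Finset.sum_congr rfl fun i _ => Finset.sum_comm

lemma generalizedRoundness_eq_one (h1 : HasRoundnessExponent d 1)
    (h : ∀ p, 0 < p → HasRoundnessExponent d p → p ≤ 1) : generalizedRoundness d = 1 := by
  apply le_antisymm
  · refine sSup_le ?_
    rintro _ ⟨p, ⟨hp0, hp⟩, rfl⟩
    exact ENNReal.ofReal_le_one.2 (h p hp0 hp)
  · exact le_sSup ⟨1, ⟨one_pos, h1⟩, ENNReal.ofReal_one⟩

lemma le_one_of_two_rpow_le {p : ℝ} (h : (2 : ℝ) ^ p ≤ 2) : p ≤ 1 := by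
  rwa [← Real.rpow_le_rpow_left_iff (x := 2) one_lt_two, Real.rpow_one]

/-- A quadrilateral with unit sides and both diagonals equal to two bounds the roundness by one. -/
lemma HasRoundnessExponent.le_one_of_square {p : ℝ} (hd : HasRoundnessExponent d p)
    {x y z w : X} (hxz : d x z = 2) (hyw : d y w = 2)
    (hxy : d x y = 1) (hyz : d z y = 1) (hzw : d z w = 1) (hwx : d x w = 1) : p ≤ 1 := by
  have h := hd 2 le_rfl ![x, z] ![y, w]
  have h0 : Finset.Ioi (0 : Fin 2) = {1} := by decide
  have h1 : Finset.Ioi (1 : Fin 2) = ∅ := by decide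
  simp [Fin.sum_univ_two, h0, h1, hxz, hyw, hxy, hyz, hzw, hwx] at h
  exact le_one_of_two_rpow_le (by linarith)

/-- A space with large, almost optimally separated sets of points at almost the same distance of a
centre has roundness at most one. -/
lemma HasRoundnessExponent.le_one_of_star {p : ℝ} (hd : HasRoundnessExponent d p)
    (hp : 0 < p) (hnn : ∀ x y, 0 ≤ d x y) (o : X) (ho : d o o = 0)
    (h : ∀ r k : ℕ, ∃ a : Fin r → X, (∀ i, d (a i) o ≤ k + r) ∧
      ∀ i j, i < j → (2 * k : ℝ) ≤ d (a i) (a j)) : p ≤ 1 := by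
  have key : ∀ r : ℕ, 2 ≤ r → ((r : ℝ) - 1) / r * 2 ^ p ≤ 2 * (1 + 1 / (r : ℝ)) ^ p := by
    intro r hr
    have hr0 : (0 : ℝ) < r := by positivity
    obtain ⟨a, hao, haa⟩ := h r (r ^ 2)
    push_cast at hao haa
    have hineq := hd r hr a (fun _ => o)
    have hupper : ∑ i : Fin r, ∑ j : Fin r, d (a i) o ^ p ≤
        (r : ℝ) * (r * ((r : ℝ) ^ 2 + r) ^ p) := by
      calc _ ≤ ∑ i : Fin r, ∑ j : Fin r, ((r : ℝ) ^ 2 + r) ^ p :=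
            Finset.sum_le_sum fun i _ => Finset.sum_le_sum fun j _ =>
              Real.rpow_le_rpow (hnn _ _) (hao i) hp.le
        _ = _ := by simp
    set C : ℝ := (2 * (r : ℝ) ^ 2) ^ p
    have hlower : ∑ i : Fin r, ∑ j ∈ Finset.Ioi i, C ≤
        ∑ i : Fin r, ∑ j ∈ Finset.Ioi i, (d (a i) (a j) ^ p + d o o ^ p) := by
      refine Finset.sum_le_sum fun i _ => Finset.sum_le_sum fun j hj => ?_
      rw [ho, Real.zero_rpow hp.ne', add_zero]
      exact Real.rpow_le_rpow (by positivity) (haa i j (Finset.mem_Ioi.1 hj)) hp.le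
    have hcount : 2 * ∑ i : Fin r, ∑ j ∈ Finset.Ioi i, C = (r * r - r) * C := by
      have := sum_sum_eq_two_mul_sum_Ioi (fun i j : Fin r => if i = j then 0 else C)
        (fun i j => by simp [eq_comm]) (fun i => by simp)
      have h2 : ∀ i : Fin r, ∑ j ∈ Finset.Ioi i, (if i = j then 0 else C) =
          ∑ j ∈ Finset.Ioi i, C := fun i =>
        Finset.sum_congr rfl fun j hj => if_neg (Finset.mem_Ioi.1 hj).ne
      simp only [h2] at this
      rw [← this]
      have h3 : ∀ i j : Fin r, (if i = j then 0 else C) = C - if i = j then C else 0 := by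
        intro i j; split_ifs <;> simp
      simp only [h3, Finset.sum_sub_distrib, Finset.sum_ite_eq, Finset.sum_const, Finset.card_univ,
        Fintype.card_fin, nsmul_eq_mul, Finset.mem_univ, if_true]
      ring
    have hC : C = 2 ^ p * ((r : ℝ) ^ 2) ^ p := Real.mul_rpow (by norm_num) (by positivity)
    have hD : ((r : ℝ) ^ 2 + r) ^ p = (1 + 1 / (r : ℝ)) ^ p * ((r : ℝ) ^ 2) ^ p := by
      rw [← Real.mul_rpow (by positivity) (by positivity)]
      congr 1
      field_simp
    have hpos : 0 < ((r : ℝ) ^ 2) ^ p := by positivity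
    have hfin : (r * r - r) * C ≤ 2 * ((r : ℝ) * (r * ((r : ℝ) ^ 2 + r) ^ p)) := by
      rw [← hcount]
      linarith
    rw [hC, hD] at hfin
    have hq : 0 < (r : ℝ) * r * ((r : ℝ) ^ 2) ^ p := by positivity
    refine le_of_mul_le_mul_right ?_ hq
    calc _ = ((r : ℝ) * r - r) * (2 ^ p * ((r : ℝ) ^ 2) ^ p) := by field_simp
      _ ≤ _ := hfin
      _ = _ := by ring
  have hinv : Filter.Tendsto (fun r : ℕ => 1 / (r : ℝ)) Filter.atTop (nhds 0) :=
    tendsto_one_div_atTop_nhds_zero_nat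
  have hl : Filter.Tendsto (fun r : ℕ => (1 - 1 / (r : ℝ)) * 2 ^ p) Filter.atTop
      (nhds ((1 - 0) * 2 ^ p)) := (hinv.const_sub 1).mul_const _
  have hr : Filter.Tendsto (fun r : ℕ => 2 * (1 + 1 / (r : ℝ)) ^ p) Filter.atTop
      (nhds (2 * (1 + 0) ^ p)) :=
    ((hinv.const_add 1).rpow_const (Or.inr hp.le)).const_mul 2
  have hle := le_of_tendsto_of_tendsto hl hr (by
    filter_upwards [Filter.eventually_ge_atTop 2] with r hr
    have hr0 : (r : ℝ) ≠ 0 := by positivity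
    have := key r hr
    rwa [sub_div, div_self hr0] at this)
  refine le_one_of_two_rpow_le ?_
  simpa using hle

end Roundness

section Lattice

open Finset in
lemma exists_word_of_lattice {ι : Type*} [DecidableEq ι] (g : ι → ℤ) (s : Finset ι) :
    ∃ w : List (ι → ℤ),
      (∀ x ∈ w, x ∈ Set.range (fun i : ι => (Pi.single i 1 : ι → ℤ)) ∨
        -x ∈ Set.range (fun i : ι => (Pi.single i 1 : ι → ℤ))) ∧
      w.sum = ∑ i ∈ s, Pi.single i (g i) ∧ w.length = ∑ i ∈ s, (g i).natAbs := by
  induction s using Finset.induction_on with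
  | empty => exact ⟨[], by simp⟩
  | insert i s hi ih =>
    obtain ⟨w, hw, hsum, hlen⟩ := ih
    refine ⟨List.replicate (g i).natAbs (Pi.single i (g i).sign) ++ w, ?_, ?_, ?_⟩
    · intro x hx
      rcases List.mem_append.1 hx with hx | hx
      · obtain ⟨hne, rfl⟩ := List.mem_replicate.1 hx
        rcases lt_trichotomy (g i) 0 with h | h | h
        · exact Or.inr ⟨i, by simp [Int.sign_eq_neg_one_of_neg h, ← Pi.single_neg]⟩
        · simp [h] at hne
        · exact Or.inl ⟨i, by simp [Int.sign_eq_one_of_pos h]⟩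
      · exact hw x hx
    · rw [List.sum_append, hsum, Finset.sum_insert hi, List.sum_replicate, ← Pi.single_smul,
        nsmul_eq_mul, mul_comm, Int.sign_mul_natAbs]
    · simp [hlen, Finset.sum_insert hi]

lemma addWordLength_lattice {ι : Type*} [Fintype ι] [DecidableEq ι] (g : ι → ℤ) :
    addWordLength (Set.range (fun i : ι => (Pi.single i 1 : ι → ℤ))) g =
      ∑ i, (g i).natAbs := by
  apply le_antisymm
  · obtain ⟨w, hw, hsum, hlen⟩ := exists_word_of_lattice g Finset.univ
    exact Nat.sInf_le ⟨w, hw, by rw [hsum, Finset.univ_sum_single], hlen⟩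
  · obtain ⟨w₀, hw₀, hsum₀, hlen₀⟩ := exists_word_of_lattice g Finset.univ
    refine le_csInf ⟨_, w₀, hw₀, by rw [hsum₀, Finset.univ_sum_single], rfl⟩ ?_
    rintro _ ⟨w, hw, rfl, rfl⟩
    clear hsum₀ hlen₀
    induction w with
    | nil => simp
    | cons x w ih =>
      have hx : ∑ i, (x i).natAbs = 1 := by
        have hs : ∀ j : ι, ∑ i, ((Pi.single j 1 : ι → ℤ) i).natAbs = 1 := fun j => by
          simp [Pi.single_apply, apply_ite Int.natAbs]
        rcases hw x (by simp) with ⟨j, rfl⟩ | ⟨j, hj⟩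
        · exact hs j
        · rw [← hs j]
          simp only at hj
          simp [hj]
      have := ih (fun y hy => hw y (by simp [hy]))
      calc ∑ i, ((x :: w).sum i).natAbs ≤ ∑ i, ((x i).natAbs + (w.sum i).natAbs) :=
            Finset.sum_le_sum fun i _ => by
              rw [List.sum_cons]
              exact Int.natAbs_add_le _ _
        _ ≤ _ := by
            rw [Finset.sum_add_distrib, hx, List.length_cons]
            omega

lemma addWordDist_lattice {ι : Type*} [Fintype ι] [DecidableEq ι] (g h : ι → ℤ) :
    addWordDist (Set.range (fun i : ι => (Pi.single i 1 : ι → ℤ))) g h =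
      ∑ i, ((h i - g i).natAbs : ℝ) := by
  rw [addWordDist, addWordLength_lattice]
  push_cast
  exact Finset.sum_congr rfl fun i _ => by simp [neg_add_eq_sub]

lemma hasRoundnessExponent_one_lattice (n : ℕ) :
    HasRoundnessExponent
      (addWordDist (Set.range (fun i : Fin n => (Pi.single i 1 : Fin n → ℤ)))) 1 := by
  refine hasRoundnessExponent_one_of_card fun A hA => ?_
  obtain ⟨L, hL⟩ := hA.bddBelow
  refine ⟨Σ _ : Fin n, ℤ, inferInstance,
    fun x => Finset.univ.sigma fun i => Finset.Ico (L i) (x i), fun x hx y hy => ?_⟩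
  have hinter : (Finset.univ.sigma fun i => Finset.Ico (L i) (x i)) ∩
      (Finset.univ.sigma fun i => Finset.Ico (L i) (y i)) =
      Finset.univ.sigma fun i => Finset.Ico (L i) (min (x i) (y i)) := by
    ext ⟨i, t⟩
    simp only [Finset.mem_inter, Finset.mem_sigma, Finset.mem_univ, true_and, Finset.mem_Ico,
      lt_min_iff]
    tauto
  rw [hinter, addWordDist_lattice]
  simp only [Finset.card_sigma, Int.card_Ico]
  have key : ∀ i, (y i - x i).natAbs + 2 * (min (x i) (y i) - L i).toNat =
      (x i - L i).toNat + (y i - L i).toNat := fun i => by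
    have h1 : L i ≤ x i := hL hx i
    have h2 : L i ≤ y i := hL hy i
    omega
  have hsum := congrArg (Nat.cast : ℕ → ℝ)
    (Finset.sum_congr rfl fun i (_ : i ∈ Finset.univ) => key i)
  simp only [Finset.sum_add_distrib, ← Finset.mul_sum, Nat.cast_add, Nat.cast_sum, Nat.cast_mul,
    Nat.cast_ofNat] at hsum
  simp only [Nat.cast_sum]
  linarith

end Lattice

section Free

open FreeGroup

variable {α : Type*}

lemma wordLength_lift {G : Type*} [Group G] [DecidableEq G] {S : Set G}
    (hS : IsFreeGeneratingSet S) (x : FreeGroup S) :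
    wordLength S (FreeGroup.lift (fun s : S => (s : G)) x) = FreeGroup.norm x := by
  set φ := FreeGroup.lift (fun s : S => (s : G))
  have hmem : ∃ w : List G, (∀ y ∈ w, y ∈ S ∨ y⁻¹ ∈ S) ∧ w.prod = φ x ∧
      w.length = FreeGroup.norm x := by
    refine ⟨x.toWord.map fun q => cond q.2 (q.1 : G) (q.1 : G)⁻¹, ?_, ?_, by simp [FreeGroup.norm]⟩
    · intro y hy
      obtain ⟨⟨s, b⟩, _, rfl⟩ := List.mem_map.1 hy
      cases b <;> simp
    · conv_rhs => rw [← mk_toWord (x := x)]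
      rw [FreeGroup.lift_mk]
  refine le_antisymm (Nat.sInf_le hmem) (le_csInf ⟨_, hmem⟩ ?_)
  rintro _ ⟨w, hw, hprod, rfl⟩
  have hex : ∃ z : FreeGroup S, φ z = w.prod ∧ FreeGroup.norm z ≤ w.length := by
    clear hprod hmem
    induction w with
    | nil => exact ⟨1, by simp⟩
    | cons y w ih =>
      obtain ⟨z, hz, hzl⟩ := ih fun u hu => hw u (by simp [hu])
      obtain ⟨v, hv, hvl⟩ : ∃ v : FreeGroup S, φ v = y ∧ FreeGroup.norm v = 1 := by
        rcases hw y (by simp) with h | h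
        · exact ⟨of ⟨y, h⟩, by simp [φ], norm_of _⟩
        · exact ⟨(of ⟨y⁻¹, h⟩)⁻¹, by simp [φ], by rw [norm_inv_eq, norm_of]⟩
      refine ⟨v * z, by simp [hv, hz], (FreeGroup.norm_mul_le _ _).trans ?_⟩
      rw [hvl, List.length_cons]
      omega
  obtain ⟨z, hz, hzl⟩ := hex
  rwa [hS.1 (hz.trans hprod)] at hzl

lemma wordDist_lift {G : Type*} [Group G] [DecidableEq G] {S : Set G}
    (hS : IsFreeGeneratingSet S) (x y : FreeGroup S) :
    wordDist S (FreeGroup.lift (fun s : S => (s : G)) x)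
      (FreeGroup.lift (fun s : S => (s : G)) y) = FreeGroup.norm (x⁻¹ * y) := by
  rw [wordDist, ← MonoidHom.map_inv, ← MonoidHom.map_mul, wordLength_lift hS]

lemma FreeGroup.norm_mk_of_isReduced [DecidableEq α] {L : List (α × Bool)}
    (h : FreeGroup.IsReduced L) :
    FreeGroup.norm (FreeGroup.mk L) = L.length := by
  rw [FreeGroup.norm, toWord_mk, h.reduce_eq]

lemma FreeGroup.isReduced_invRev {L : List (α × Bool)} (h : FreeGroup.IsReduced L) :
    FreeGroup.IsReduced (invRev L) := by
  classical
  rw [isReduced_iff_reduce_eq] at h ⊢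
  rw [reduce_invRev, h]

lemma FreeGroup.isReduced_invRev_append {a b : α × Bool} {L M : List (α × Bool)}
    (hL : FreeGroup.IsReduced (a :: L)) (hM : FreeGroup.IsReduced (b :: M)) (hab : a ≠ b) :
    FreeGroup.IsReduced (invRev (a :: L) ++ b :: M) := by
  refine List.IsChain.append (isReduced_invRev hL) hM ?_
  intro x hx y hy
  obtain rfl : b = y := by simpa using hy
  rw [invRev_cons] at hx
  obtain rfl : (a.1, !a.2) = x := by simpa [invRev] using hx
  rintro h
  obtain ⟨a1, a2⟩ := a
  obtain ⟨b1, b2⟩ := b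
  simp only at h
  subst h
  cases a2 <;> cases b2 <;> simp_all

lemma List.card_inits_toFinset [DecidableEq α] (L : List α) :
    L.inits.toFinset.card = L.length + 1 := by
  induction L with
  | nil => simp
  | cons a L ih =>
    rw [List.inits_cons, List.toFinset_cons, Finset.card_insert_of_notMem (by simp)]
    have : (L.inits.map fun t => a :: t).toFinset = L.inits.toFinset.image (a :: ·) := by
      ext; simp
    rw [this, Finset.card_image_of_injective _ (List.cons_injective), ih, List.length_cons]

lemma FreeGroup.norm_inv_mk_mul_mk [DecidableEq α] {L M : List (α × Bool)}
    (hL : FreeGroup.IsReduced L) (hM : FreeGroup.IsReduced M) :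
    FreeGroup.norm ((FreeGroup.mk L)⁻¹ * FreeGroup.mk M) +
        2 * (L.inits.toFinset ∩ M.inits.toFinset).card =
      L.length + M.length + 2 := by
  have base : ∀ {L M : List (α × Bool)}, FreeGroup.IsReduced (invRev L ++ M) →
      L.inits.toFinset ∩ M.inits.toFinset = {[]} →
      FreeGroup.norm ((FreeGroup.mk L)⁻¹ * FreeGroup.mk M) +
        2 * (L.inits.toFinset ∩ M.inits.toFinset).card = L.length + M.length + 2 := by
    intro L M h h'
    rw [inv_mk, mul_mk, norm_mk_of_isReduced h, h']
    simp
  induction L generalizing M with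
  | nil => exact base (by simpa using hM) (by ext; simp +contextual)
  | cons a L ih =>
    cases M with
    | nil => exact base (by simpa using (isReduced_invRev hL)) (by ext; simp +contextual)
    | cons b M =>
      by_cases hab : a = b
      · subst hab
        have hc : (FreeGroup.mk (a :: L))⁻¹ * FreeGroup.mk (a :: M) =
            (FreeGroup.mk L)⁻¹ * FreeGroup.mk M := by
          have : ∀ N, FreeGroup.mk (a :: N) = FreeGroup.mk [a] * FreeGroup.mk N := fun N => by
            rw [mul_mk]; rfl
          rw [this L, this M]
          group
        have hi : (a :: L).inits.toFinset ∩ (a :: M).inits.toFinset =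
            insert [] ((L.inits.toFinset ∩ M.inits.toFinset).image (a :: ·)) := by
          ext t
          cases t <;> simp
          tauto
        have hih := ih (hL.infix (List.suffix_cons a L).isInfix)
          (hM.infix (List.suffix_cons a M).isInfix)
        rw [hc, hi, Finset.card_insert_of_notMem (by simp),
          Finset.card_image_of_injective _ List.cons_injective, List.length_cons, List.length_cons]
        omega
      · refine base (isReduced_invRev_append hL hM hab) ?_
        ext t
        cases t with
        | nil => simp
        | cons c t =>
          simp only [Finset.mem_inter, List.mem_toFinset, List.mem_inits, List.cons_prefix_cons,
            Finset.mem_singleton, reduceCtorEq, iff_false]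
          rintro ⟨⟨rfl, -⟩, rfl, -⟩
          exact hab rfl

lemma FreeGroup.norm_inv_mul_eq_card [DecidableEq α] (x y : FreeGroup α) :
    (FreeGroup.norm (x⁻¹ * y) : ℝ) = x.toWord.inits.toFinset.card + y.toWord.inits.toFinset.card -
      2 * (x.toWord.inits.toFinset ∩ y.toWord.inits.toFinset).card := by
  have h := norm_inv_mk_mul_mk (isReduced_toWord (x := x)) (isReduced_toWord (x := y))
  rw [mk_toWord, mk_toWord] at h
  rw [List.card_inits_toFinset, List.card_inits_toFinset]
  push_cast
  have h' : (FreeGroup.norm (x⁻¹ * y) : ℝ) +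
      2 * (x.toWord.inits.toFinset ∩ y.toWord.inits.toFinset).card =
    x.toWord.length + y.toWord.length + 2 := by exact_mod_cast h
  linarith

lemma le_norm_conj_pow [DecidableEq α] {s t : α} (hst : s ≠ t) (k m : ℕ) (hm : m ≠ 0) :
    2 * k ≤ FreeGroup.norm ((of t ^ k)⁻¹ * of s ^ m * of t ^ k) := by
  have hpow : ∀ (u : α) (l : ℕ), of u ^ l = FreeGroup.mk (List.replicate l (u, true)) :=
    fun u l => by rw [← toWord_of_pow, mk_toWord]
  have hrep : ∀ (u : α × Bool) (l : ℕ), FreeGroup.IsReduced (List.replicate l u) :=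
    fun u l => List.isChain_replicate_of_rel _ fun _ => rfl
  have hred : FreeGroup.IsReduced (List.replicate k (t, false) ++
      (List.replicate m (s, true) ++ List.replicate k (t, true))) := by
    refine List.IsChain.append (hrep _ _) (List.IsChain.append (hrep _ _) (hrep _ _) ?_) ?_
    · intro x hx y hy h
      have hx' := List.eq_of_mem_replicate (List.mem_of_mem_getLast? hx)
      have hy' := List.eq_of_mem_replicate (List.mem_of_mem_head? hy)
      subst hx' hy'
      rfl
    · intro x hx y hy h
      have hx' := List.eq_of_mem_replicate (List.mem_of_mem_getLast? hx)
      obtain ⟨m, rfl⟩ := Nat.exists_eq_succ_of_ne_zero hm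
      obtain rfl : (s, true) = y := by simpa [List.replicate_succ] using hy
      subst hx'
      exact absurd h.symm hst
  have hinv : invRev (List.replicate k (t, true)) = List.replicate k (t, false) := by
    simp [invRev]
  rw [hpow, hpow, inv_mk, hinv, mul_mk, mul_mk, List.append_assoc, norm_mk_of_isReduced hred]
  simp
  omega

lemma nontrivial_of_isFreeGeneratingSet {n : ℕ} (hn : 2 ≤ n) {S : Set (FreeGroup (Fin n))}
    (hS : IsFreeGeneratingSet S) : Nontrivial S := by
  have e : S ≃ Fin n := Equiv.ofFreeGroupEquiv (MulEquiv.ofBijective _ hS)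
  have : Nontrivial (Fin n) := Fin.nontrivial_iff_two_le.2 hn
  exact e.nontrivial

lemma hasRoundnessExponent_one_free {G : Type} [Group G] {S : Set G}
    (hS : IsFreeGeneratingSet S) : HasRoundnessExponent (wordDist S) 1 := by
  classical
  refine hasRoundnessExponent_one_of_card fun _ _ => ?_
  set e := Function.surjInv hS.2
  refine ⟨List (S × Bool), inferInstance, fun g => (e g).toWord.inits.toFinset,
    fun x _ y _ => ?_⟩
  rw [← norm_inv_mul_eq_card, ← wordDist_lift hS, Function.surjInv_eq hS.2,
    Function.surjInv_eq hS.2]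

lemma HasRoundnessExponent.le_one_of_free {G : Type*} [Group G] {S : Set G}
    (hS : IsFreeGeneratingSet S) (hS' : Nontrivial S) {p : ℝ} (hp : 0 < p)
    (h : HasRoundnessExponent (wordDist S) p) : p ≤ 1 := by
  classical
  obtain ⟨s, t, hst⟩ := hS'
  set φ := FreeGroup.lift (fun s : S => (s : G))
  refine h.le_one_of_star hp (fun _ _ => Nat.cast_nonneg _) (φ 1) ?_ fun r k => ?_
  · rw [wordDist_lift hS]
    simp
  · refine ⟨fun i => φ (of s ^ (i : ℕ) * of t ^ k), fun i => ?_, fun i j hij => ?_⟩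
    · rw [wordDist_lift hS, mul_one, norm_inv_eq]
      have := FreeGroup.norm_mul_le (of s ^ (i : ℕ)) (of t ^ k)
      rw [norm_of_pow, norm_of_pow] at this
      exact_mod_cast (by omega : FreeGroup.norm (of s ^ (i : ℕ) * of t ^ k) ≤ k + r)
    · rw [wordDist_lift hS]
      have hij' : (i : ℕ) < j := hij
      obtain ⟨m, hm⟩ := Nat.exists_eq_add_of_lt hij'
      have h1 : (of s ^ (i : ℕ) * of t ^ k)⁻¹ * (of s ^ (j : ℕ) * of t ^ k) =
          (of t ^ k)⁻¹ * of s ^ (m + 1) * of t ^ k := by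
        rw [hm, add_assoc, pow_add (of s) (i : ℕ)]
        group
      rw [h1]
      exact_mod_cast le_norm_conj_pow hst k (m + 1) (by omega)

end Free

theorem mainTheorem1 (n : ℕ) (hn : 2 ≤ n) :
    generalizedRoundness
        (addWordDist (Set.range (fun i : Fin n => (Pi.single i 1 : Fin n → ℤ)))) = 1 ∧
      ∀ S : Set (FreeGroup (Fin n)), IsFreeGeneratingSet S →
        generalizedRoundness (wordDist S) = 1 := by
  refine ⟨generalizedRoundness_eq_one (hasRoundnessExponent_one_lattice n) fun p hp h => ?_,
    fun S hS => generalizedRoundness_eq_one (hasRoundnessExponent_one_free hS) fun p hp h =>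
      h.le_one_of_free hS (nontrivial_of_isFreeGeneratingSet hn hS) hp⟩
  obtain ⟨m, rfl⟩ := Nat.exists_eq_add_of_le' hn
  refine h.le_one_of_square (x := 0) (y := Pi.single 0 1)
    (z := Pi.single 0 1 + Pi.single 1 1) (w := Pi.single 1 1) ?_ ?_ ?_ ?_ ?_ ?_ <;>
  · rw [addWordDist_lattice, Fin.sum_univ_succ, Fin.sum_univ_succ]
    norm_num [Pi.single_apply, Fin.ext_iff]
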